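/- Let $\mathbf A$ be a finite lattice algebra, i.e. a finite (hence bounded, with bottom $0$ and top $1$) lattice $\langle A,\wedge,\vee\rangle$ possibly expanded with further finitary operations, and let $\tau$ be a denumerable set of propositional variables. Modal formulas are built from $\tau$ with $\wedge$, $\vee$, an $n$-ary connective for each additional $n$-ary operation of $\mathbf A$, and the unary modalities $\Diamond$, $\Box$. A frame $\langle W,R\rangle$ is a non-empty set $W$ with a binary relation $R\subseteq W^2$. Given a valuation $V:\tau\times W\to A$, the value $\|\varphi\|_w\in A$ of a formula $\varphi$ at $w\in W$ is given by $\|p\|_w=V(p,w)$ for $p\in\tau$, by the operations of $\mathbf A$ for the connectives, and by $\|\Diamond\varphi\|_w=\sup\{\|\varphi\|_v : Rwv\}$, $\|\Box\varphi\|_w=\inf\{\|\varphi\|_v : Rwv\}$. A formula $\varphi$ is $\mathbf A$-valid in a frame if $\|\varphi\|_w=1$ for all valuations $V$ and all worlds $w$. A class $\mathbb F$ of frames is modally $\mathbf A$-definable if there is a set $\Phi$ of formulas such that $\mathbb F$ consists of exactly those frames in which every $\varphi\in\Phi$ is $\mathbf A$-valid. Suppose that $\mathbf A$ interprets a non-trivial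 Boolean algebra via a term: there are unary terms $u(x)$ and $t(x)$ (modality-free, in the language of $\mathbf A$) and a Boolean algebra $\mathbf B$ with more than one element such that, writing $\neg x$ for $u(x)$, (i) the relation $\{(x,y)\in A^2 : t(x)=t(y)\}$ is a congruence of $\langle A,\wedge,\vee,0,1,\neg\rangle$, (ii) $t(1)=1$, and (iii) the quotient of $\langle A,\wedge,\vee,1,\neg\rangle$ by this congruence is isomorphic to $\mathbf B$. Let $\mathbb F$ be an elementary class of frames, i.e. the class of all frames satisfying some set of first-order sentences in the language with equality and one binary relation symbol. Then $\mathbb F$ is modally $\mathbf A$-definable if and only if all of the following hold: 1. $\mathbb F$ is closed under generated subframes: if $\langle W,R\rangle\in\mathbb F$ and $X\subseteq W$ is non-empty and such that $w\in X$ and $Rwv$ imply $v\in X$, then $\langle X,R\cap X^2\rangle\in\mathbb F$; 2. $\mathbb F$ is closed under disjoint unions of non-empty families; 3. $\mathbb F$ is closed under bounded morphic images: if $\langle W,R\rangle\in\mathbb F$ and $f:W\to W'$ is a surjection onto the worlds of a frame $\langle W',R'\rangle$ such that $Rwv$ implies $R'f(w)f(v)$, and $R'f(w)v'$ implies that $Rwv$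 for some $v$ with $f(v)=v'$, then $\langle W',R'\rangle\in\mathbb F$; 4. $\mathbb F$ reflects ultrafilter extensions: if the frame whose worlds are the ultrafilters on $W$, where $a$ sees $b$ iff $\{w : Rwv\text{ for some }v\in X\}\in a$ for every $X\in b$, belongs to $\mathbb F$, then $\langle W,R\rangle\in\mathbb F$. -/

import Mathlib

universe u v w x

namespace FVModal

/-! ## Lattice algebras, formulas and terms -/

/-- A signature for the operations that a lattice algebra has besides its lattice operations.
Constants are operations of arity `0`. -/
structure Signature : Type (w + 1) where
  /-- the additional operation symbols -/
  Op : Type w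
  /-- the arity of each additional operation symbol -/
  arity : Op → ℕ

/-- An interpretation of the additional operation symbols of `S` on `A`. A finite lattice algebra
is a type `A` with `[Lattice A] [BoundedOrder A] [Finite A] [Ops S A]`. -/
class Ops (S : Signature.{w}) (A : Type v) : Type (max v w) where
  /-- the operation on `A` named by a symbol -/
  op : (o : S.Op) → (Fin (S.arity o) → A) → A

/-- Formulas of the modal language of a lattice algebra of signature `S`, with propositional
variables in `τ`. -/
inductive Formula (S : Signature.{w}) (τ : Type x) : Type (max w x)
  | var (p : τ) : Formula S τ
  | and (φ ψ : Formula S τ) : Formula S τ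
  | or (φ ψ : Formula S τ) : Formula S τ
  | op (o : S.Op) (φ : Fin (S.arity o) → Formula S τ) : Formula S τ
  | dia (φ : Formula S τ) : Formula S τ
  | box (φ : Formula S τ) : Formula S τ

/-- Unary algebraic terms `t(x)` (modality-free, in the one variable `x`) in the language of a
lattice algebra of signature `S`. -/
inductive UnaryTerm (S : Signature.{w}) : Type w
  | x : UnaryTerm S
  | and (s t : UnaryTerm S) : UnaryTerm S
  | or (s t : UnaryTerm S) : UnaryTerm S
  | op (o : S.Op) (t : Fin (S.arity o) → UnaryTerm S) : UnaryTerm S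

/-- The term function `A → A` of a unary term. -/
def UnaryTerm.eval {S : Signature.{w}} (A : Type v) [Lattice A] [Ops S A] :
    UnaryTerm S → A → A
  | .x, a => a
  | .and s t, a => s.eval A a ⊓ t.eval A a
  | .or s t, a => s.eval A a ⊔ t.eval A a
  | .op o t, a => Ops.op o fun i => (t i).eval A a

/-! ## Interpretation of a Boolean algebra via a term -/

/-- The equivalence relation `Eq(t) = {(x, y) | t(x) = t(y)}` on `A`. -/
def termKer {S : Signature.{w}} (A : Type v) [Lattice A] [Ops S A] (t : UnaryTerm S) : Setoid A :=
  Setoid.ker (t.eval A)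

/-- The equivalence relation `r` is a congruence of the algebra `(A, ∧, ∨, 0, 1, ¬)` in which
`¬ a = u(a)`. -/
structure IsReductCongruence {S : Signature.{w}} (A : Type v) [Lattice A] [Ops S A]
    (u : UnaryTerm S) (r : Setoid A) : Prop where
  inf : ∀ a a' b b' : A, r a a' → r b b' → r (a ⊓ b) (a' ⊓ b')
  sup : ∀ a a' b b' : A, r a a' → r b b' → r (a ⊔ b) (a' ⊔ b')
  neg : ∀ a a' : A, r a a' → r (u.eval A a) (u.eval A a')

/-- The algebra `B` (with its operations `∧, ∨, 1, ¬`) is interpretable in `A`, where `¬ a = u(a)`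
in `A`, via the term `t`: the relation `Eq(t)` is a congruence of `(A, ∧, ∨, 0, 1, ¬)`, `t(1) = 1`,
and there is an isomorphism `e` from the quotient onto `B`. -/
structure IsInterpretation {S : Signature.{w}} (A : Type v) [Lattice A] [BoundedOrder A] [Ops S A]
    (u t : UnaryTerm S) (B : Type v) [BooleanAlgebra B] : Prop where
  congruence : IsReductCongruence A u (termKer A t)
  map_one : t.eval A ⊤ = ⊤
  iso : ∃ e : Quotient (termKer A t) ≃ B,
    (∀ a b : A, e (Quotient.mk _ (a ⊓ b)) = e (Quotient.mk _ a) ⊓ e (Quotient.mk _ b)) ∧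
    (∀ a b : A, e (Quotient.mk _ (a ⊔ b)) = e (Quotient.mk _ a) ⊔ e (Quotient.mk _ b)) ∧
    (∀ a : A, e (Quotient.mk _ (u.eval A a)) = (e (Quotient.mk _ a))ᶜ) ∧
    e (Quotient.mk _ ⊤) = ⊤

/-- `A` interprets a (non-trivial) Boolean algebra via some term `t`, for some choice of the term
`u` that serves as the negation of `A`. The Boolean algebra is isomorphic to a quotient of `A`, so
nothing is lost by taking it in the universe of `A`. -/
def InterpretsBooleanAlgebra (S : Signature.{w}) (A : Type v) [Lattice A] [BoundedOrder A]
    [Ops S A] : Prop :=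
  ∃ (u t : UnaryTerm S) (B : Type v) (_ : BooleanAlgebra B) (_ : Nontrivial B),
    IsInterpretation A u t B

/-! ## Frames and many-valued Kripke semantics -/

/-- A (crisp) Kripke frame: a non-empty set of worlds with a binary accessibility relation. -/
structure Frame : Type (u + 1) where
  /-- the worlds -/
  W : Type u
  nonempty : Nonempty W
  /-- the accessibility relation -/
  R : W → W → Prop

/-- The supremum of a subset of a finite bounded lattice. -/
noncomputable def finSup {A : Type v} [Lattice A] [BoundedOrder A] [Finite A] (X : Set A) : A :=
  X.toFinite.toFinset.sup id

/-- The infimum of a subset of a finite bounded lattice. -/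
noncomputable def finInf {A : Type v} [Lattice A] [BoundedOrder A] [Finite A] (X : Set A) : A :=
  X.toFinite.toFinset.inf id

theorem isLUB_finSup {A : Type v} [Lattice A] [BoundedOrder A] [Finite A] (X : Set A) :
    IsLUB X (finSup X) := by
  simpa [finSup] using X.toFinite.toFinset.isLUB_sup_id

theorem isGLB_finInf {A : Type v} [Lattice A] [BoundedOrder A] [Finite A] (X : Set A) :
    IsGLB X (finInf X) := by
  simpa [finInf] using X.toFinite.toFinset.isGLB_inf_id

/-- The truth value of a formula at a world, in the `A`-valued model on the frame `F` given by the
valuation `V`. -/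
noncomputable def Formula.value {S : Signature.{w}} {τ : Type x} {A : Type v} [Lattice A]
    [BoundedOrder A] [Finite A] [Ops S A] (F : Frame.{u}) (V : τ → F.W → A) :
    Formula S τ → F.W → A
  | .var p, w => V p w
  | .and φ ψ, w => φ.value F V w ⊓ ψ.value F V w
  | .or φ ψ, w => φ.value F V w ⊔ ψ.value F V w
  | .op o φ, w => Ops.op o fun i => (φ i).value F V w
  | .dia φ, w => finSup {a | ∃ v, F.R w v ∧ φ.value F V v = a}
  | .box φ, w => finInf {a | ∃ v, F.R w v ∧ φ.value F V v = a}

/-- `A`-validity of a formula in a frame. -/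
def Frame.Valid {S : Signature.{w}} {τ : Type x} (A : Type v) [Lattice A] [BoundedOrder A]
    [Finite A] [Ops S A] (F : Frame.{u}) (φ : Formula S τ) : Prop :=
  ∀ (V : τ → F.W → A) (w : F.W), φ.value F V w = ⊤

/-- The class `K` of frames is modally `A`-definable by a set of formulas with variables in `τ`. -/
def ModallyDefinable (S : Signature.{w}) (A : Type v) [Lattice A] [BoundedOrder A] [Finite A]
    [Ops S A] (τ : Type x) (K : Set Frame.{u}) : Prop :=
  ∃ Φ : Set (Formula S τ), ∀ F : Frame.{u}, F ∈ K ↔ ∀ φ ∈ Φ, F.Valid A φ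

/-! ## Elementary classes of frames -/

/-- A frame as a first-order structure for the language with a single binary relation symbol, which
is interpreted by the accessibility relation. -/
instance Frame.instStructure (F : Frame.{u}) : FirstOrder.Language.graph.Structure F.W where
  RelMap | .adj => fun a => F.R (a 0) (a 1)

/-- An elementary class of frames: the class of all frames that satisfy some set of first-order
sentences in the language with one binary relation symbol (and equality). -/
def IsElementary (K : Set Frame.{u}) : Prop :=
  ∃ T : FirstOrder.Language.graph.Theory, ∀ F : Frame.{u}, F ∈ K ↔ F.W ⊨ T

/-! ## Frame constructions and closure conditions -/

/-- The subframe on a non-empty set `X` of worlds. -/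
def Frame.restrict (F : Frame.{u}) (X : Set F.W) (hX : X.Nonempty) : Frame.{u} where
  W := X
  nonempty := hX.to_subtype
  R := fun w v => F.R w v

/-- The disjoint union of a non-empty family of frames. -/
def Frame.disjointUnion {I : Type u} [Nonempty I] (F : I → Frame.{u}) : Frame.{u} where
  W := Σ i, (F i).W
  nonempty := ⟨⟨Classical.arbitrary I, (F _).nonempty.some⟩⟩
  R := fun a b => ∃ (i : I) (w v : (F i).W), a = ⟨i, w⟩ ∧ b = ⟨i, v⟩ ∧ (F i).R w v

/-- Bounded morphisms between frames. -/
structure IsBoundedMorphism (F G : Frame.{u}) (f : F.W → G.W) : Prop where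
  forth : ∀ w v, F.R w v → G.R (f w) (f v)
  back : ∀ w v', G.R (f w) v' → ∃ v, F.R w v ∧ f v = v'

/-- The ultrafilter extension of a frame: the worlds are the ultrafilters on the set of worlds, and
`a` sees `b` iff the set of worlds that see a world in `X` belongs to `a`, for every `X` in `b`. -/
def Frame.ultrafilterExtension (F : Frame.{u}) : Frame.{u} where
  W := Ultrafilter F.W
  nonempty := F.nonempty.map pure
  R := fun a b => ∀ X ∈ b, {w | ∃ v ∈ X, F.R w v} ∈ a

/-- Closure under generated subframes, that is, subframes on a non-empty set of worlds that is
closed under accessibility. -/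
def ClosedUnderGeneratedSubframes (K : Set Frame.{u}) : Prop :=
  ∀ F ∈ K, ∀ (X : Set F.W) (hX : X.Nonempty),
    (∀ w ∈ X, ∀ v, F.R w v → v ∈ X) → F.restrict X hX ∈ K

/-- Closure under disjoint unions of non-empty families. -/
def ClosedUnderDisjointUnions (K : Set Frame.{u}) : Prop :=
  ∀ (I : Type u) [Nonempty I] (F : I → Frame.{u}), (∀ i, F i ∈ K) → Frame.disjointUnion F ∈ K

/-- Closure under images of surjective bounded morphisms. -/
def ClosedUnderBoundedMorphicImages (K : Set Frame.{u}) : Prop :=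
  ∀ F ∈ K, ∀ (G : Frame.{u}) (f : F.W → G.W),
    Function.Surjective f → IsBoundedMorphism F G f → G ∈ K

/-- Reflection of ultrafilter extensions. -/
def ReflectsUltrafilterExtensions (K : Set Frame.{u}) : Prop :=
  ∀ F : Frame.{u}, F.ultrafilterExtension ∈ K → F ∈ K

end FVModal

/-!
The implication from definability to the closure conditions is a computation with truth values:
they are invariant under bounded morphisms (`IsBoundedMorphism.value_comp`), and, since `A` is
finite, a valuation extends to the ultrafilter extension by taking the value that is assumed almost
everywhere, which every formula then respects (`Formula.eventually_value_eq`).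

For the converse, the atoms of the interpreted Boolean algebra turn truth values in `A` into
classical ones. A classical formula `φ`, with `¬` read as the term `u`, has a translation that is
computed correctly modulo the kernel of `t`, and `t` is `⊤` exactly on the class of `⊤`; so the
`A`-validity of `t` applied to the translation is the classical validity of `φ`
(`IsInterpretation.valid_subst_translate_iff`). It remains to prove the classical Goldblatt–Thomason
theorem, `mem_of_logic`: if `F` validates every classical formula that is valid in `K`, then `F`
belongs to `K`.

Name every set of worlds of `F` by a variable. For an ultrafilter `a` on the worlds of `F`, finite
parts of the set of formulas that hold at `a`-almost all worlds are satisfiable in `F`, hence in `K`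
after a renaming of variables. By an ultraproduct the whole set holds at some world of a frame in
`K`, and the subframe generated by this world carries a map to the ultrafilters on `F` under which
the named sets and their preimages have the intended meaning (`exists_over_of_logic`). Such a map
only lacks the back condition for successors that are specified by infinitely many sets. An
ultrapower supplies these successors for the old worlds (`Over.exists_ultrapower_edge`), so in the
limit of the iterated ultrapowers, an elementary extension by the Tarski–Vaught theorem on
elementary chains, the map is a bounded morphism to the ultrafilter extension of `F`
(`Over.isBoundedMorphism_limit`). The disjoint union of these limits over all `a` is mapped onto the
ultrafilter extension, which is therefore in `K`, and so is `F`.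
-/

namespace FVModal

open Filter

/-! ### Bounded morphisms and the value of a formula -/

section Preservation

variable {S : Signature.{w}} {τ : Type x} {A : Type v} [Lattice A] [BoundedOrder A] [Finite A]
  [Ops S A]

theorem IsBoundedMorphism.succ_values {α : Type*} {F G : Frame.{u}} {f : F.W → G.W}
    (hf : IsBoundedMorphism F G f) (g : G.W → α) (w : F.W) :
    {a | ∃ v, F.R w v ∧ g (f v) = a} = {a | ∃ v, G.R (f w) v ∧ g v = a} := by
  ext a
  constructor
  · rintro ⟨v, hv, rfl⟩
    exact ⟨f v, hf.forth _ _ hv, rfl⟩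
  · rintro ⟨v', hv, rfl⟩
    obtain ⟨v, hwv, rfl⟩ := hf.back _ _ hv
    exact ⟨v, hwv, rfl⟩

/-- Truth values are invariant under pulling a valuation back along a bounded morphism. -/
theorem IsBoundedMorphism.value_comp {F G : Frame.{u}} {f : F.W → G.W}
    (hf : IsBoundedMorphism F G f) (V : τ → G.W → A) (φ : Formula S τ) (w : F.W) :
    φ.value F (fun p w => V p (f w)) w = φ.value G V (f w) := by
  induction φ generalizing w with
  | var p => rfl
  | and φ ψ h₁ h₂ => simp only [Formula.value, h₁, h₂]
  | or φ ψ h₁ h₂ => simp only [Formula.value, h₁, h₂]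
  | op o φ h => simp only [Formula.value, h]
  | dia φ h => simp only [Formula.value, h, hf.succ_values fun v => φ.value G V v]
  | box φ h => simp only [Formula.value, h, hf.succ_values fun v => φ.value G V v]

theorem Frame.isBoundedMorphism_restrict {F : Frame.{u}} {X : Set F.W} (hX : X.Nonempty)
    (h : ∀ w ∈ X, ∀ v, F.R w v → v ∈ X) :
    IsBoundedMorphism (F.restrict X hX) F Subtype.val where
  forth _ _ hwv := hwv
  back w v hwv := ⟨⟨v, h _ w.2 _ hwv⟩, hwv, rfl⟩

theorem Frame.isBoundedMorphism_disjointUnion {I : Type u} [Nonempty I] (F : I → Frame.{u})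
    (i : I) : IsBoundedMorphism (F i) (Frame.disjointUnion F) (fun w => ⟨i, w⟩) where
  forth w v hwv := ⟨i, w, v, rfl, rfl, hwv⟩
  back := by
    rintro w _ ⟨j, w', v, h, rfl, hwv⟩
    obtain ⟨rfl, h⟩ := Sigma.mk.inj_iff.1 h
    obtain rfl := eq_of_heq h
    exact ⟨v, hwv, rfl⟩

theorem Frame.Valid.restrict {F : Frame.{u}} {φ : Formula S τ} (hF : F.Valid A φ) {X : Set F.W}
    (hX : X.Nonempty) (h : ∀ w ∈ X, ∀ v, F.R w v → v ∈ X) : (F.restrict X hX).Valid A φ := by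
  classical
  intro V w
  -- Any extension of `V` to `F` will do; outside `X` it is constantly `⊤`.
  have key := (Frame.isBoundedMorphism_restrict hX h).value_comp
    (fun p w => if hw : w ∈ X then V p ⟨w, hw⟩ else ⊤) φ w
  have hV : (fun p (w : (F.restrict X hX).W) =>
      (fun p w => if hw : w ∈ X then V p ⟨w, hw⟩ else ⊤) p (Subtype.val w)) = V := by
    funext p w
    exact dif_pos w.2
  rw [hV] at key
  rw [key]
  exact hF _ _

theorem Frame.Valid.disjointUnion {I : Type u} [Nonempty I] {F : I → Frame.{u}}
    {φ : Formula S τ} (hF : ∀ i, (F i).Valid A φ) : (Frame.disjointUnion F).Valid A φ := by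
  rintro V ⟨i, w⟩
  rw [← (Frame.isBoundedMorphism_disjointUnion F i).value_comp]
  exact hF i _ _

theorem Frame.Valid.image {F G : Frame.{u}} {φ : Formula S τ} (hF : F.Valid A φ) {f : F.W → G.W}
    (hs : Function.Surjective f) (hf : IsBoundedMorphism F G f) : G.Valid A φ := by
  intro V w
  obtain ⟨w, rfl⟩ := hs w
  rw [← hf.value_comp]
  exact hF _ _

/-! ### Ultrafilter extensions and the value of a formula -/

/-- If almost all worlds, in the sense of `a`, see a world in `X`, then `a` sees an ultrafilter
that contains `X`. -/
theorem Frame.exists_ultrafilterExtension_R {F : Frame.{u}} {a : Ultrafilter F.W} {X : Set F.W}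
    (h : {w | ∃ v ∈ X, F.R w v} ∈ a) : ∃ b : Ultrafilter F.W, X ∈ b ∧
      F.ultrafilterExtension.R a b := by
  -- The sets that contain all successors of almost all worlds form the filter `L`.
  let L : Filter F.W := Filter.bind a fun w => 𝓟 {v | F.R w v}
  have hL : ∀ Y, Y ∈ L ↔ {w | ∀ v, F.R w v → v ∈ Y} ∈ a := fun Y => by
    simp only [L, Filter.mem_bind', mem_principal]
    rfl
  have hne : (L ⊓ 𝓟 X).NeBot := by
    rw [inf_principal_neBot_iff]
    intro Y hY
    obtain ⟨w, hw, v, hv, hwv⟩ := a.nonempty_of_mem (inter_mem ((hL Y).1 hY) h)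
    exact ⟨v, hw v hwv, hv⟩
  have hle := Ultrafilter.of_le (L ⊓ 𝓟 X)
  refine ⟨Ultrafilter.of (L ⊓ 𝓟 X), hle (mem_inf_of_right (mem_principal_self X)), ?_⟩
  intro Y hY
  by_contra hn
  have hc : Yᶜ ∈ L := by
    rw [hL]
    filter_upwards [Ultrafilter.compl_mem_iff_notMem.2 hn] with w hw v hwv hv
    exact hw ⟨v, hv, hwv⟩
  exact Ultrafilter.compl_notMem_iff.2 hY (hle (mem_inf_of_left hc))

/-- A function into a finite type is constant almost everywhere. -/
theorem exists_eventually_eq {A : Type*} [Finite A] {W : Type u} (a : Ultrafilter W) (g : W → A) :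
    ∃ c, ∀ᶠ w in a, g w = c := by
  obtain ⟨c, hc⟩ := (a.map g).eq_pure_of_finite
  refine ⟨c, ?_⟩
  have : ({c} : Set A) ∈ a.map g := by rw [hc]; exact Ultrafilter.mem_pure.2 rfl
  exact this

/-- The value of a formula at an ultrafilter is the value that it takes at almost all worlds. -/
theorem Formula.eventually_value_eq {F : Frame.{u}} {V : τ → F.W → A}
    {V' : τ → Ultrafilter F.W → A} (hV : ∀ p (a : Ultrafilter F.W), ∀ᶠ w in a, V p w = V' p a)
    (φ : Formula S τ) (a : Ultrafilter F.W) :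
    ∀ᶠ w in a, φ.value F V w = φ.value F.ultrafilterExtension V' a := by
  -- The set of values at the successors is almost everywhere the one at `a`. As `A` is finite, this
  -- can be checked one value at a time.
  have succ : ∀ φ : Formula S τ, (∀ a : Ultrafilter F.W,
      ∀ᶠ w in a, φ.value F V w = φ.value F.ultrafilterExtension V' a) →
      ∀ a : Ultrafilter F.W, ∀ᶠ w in a, {c | ∃ v, F.R w v ∧ φ.value F V v = c} =
        {c | ∃ b, F.ultrafilterExtension.R a b ∧
          φ.value F.ultrafilterExtension V' b = c} := by
    intro φ h a
    simp only [Set.ext_iff]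
    rw [eventually_all]
    intro c
    by_cases hc : ∃ b, F.ultrafilterExtension.R a b ∧ φ.value F.ultrafilterExtension V' b = c
    · obtain ⟨b, hb, rfl⟩ := id hc
      filter_upwards [hb _ (h b)] with w ⟨v, hv, hwv⟩
      exact ⟨fun _ => hc, fun _ => ⟨v, hwv, hv⟩⟩
    · have : {w | ∃ v ∈ {v | φ.value F V v = c}, F.R w v} ∉ a := by
        intro hm
        obtain ⟨b, hb, hab⟩ := Frame.exists_ultrafilterExtension_R hm
        obtain ⟨v, hv, hv'⟩ := b.nonempty_of_mem (inter_mem hb (h b))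
        exact hc ⟨b, hab, (Set.mem_ofPred.1 hv').symm.trans hv⟩
      filter_upwards [Ultrafilter.compl_mem_iff_notMem.2 this] with w hw
      exact ⟨fun ⟨v, hwv, hv⟩ => (hw ⟨v, hv, hwv⟩).elim, fun h => (hc h).elim⟩
  induction φ generalizing a with
  | var p => exact hV p a
  | and φ ψ h₁ h₂ =>
    filter_upwards [h₁ a, h₂ a] with w e₁ e₂
    simp only [Formula.value, e₁, e₂]
  | or φ ψ h₁ h₂ =>
    filter_upwards [h₁ a, h₂ a] with w e₁ e₂
    simp only [Formula.value, e₁, e₂]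
  | op o φ h =>
    filter_upwards [eventually_all.2 fun i => h i a] with w e
    simp only [Formula.value, e]
  | dia φ h =>
    filter_upwards [succ φ h a] with w e
    simp only [Formula.value, e]
  | box φ h =>
    filter_upwards [succ φ h a] with w e
    simp only [Formula.value, e]

theorem Frame.Valid.of_ultrafilterExtension {F : Frame.{u}} {φ : Formula S τ}
    (h : F.ultrafilterExtension.Valid A φ) : F.Valid A φ := by
  intro V w
  choose V' hV' using fun p (a : Ultrafilter F.W) => exists_eventually_eq a (V p)
  have : φ.value F V w = φ.value F.ultrafilterExtension V' (pure w : Ultrafilter F.W) :=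
    φ.eventually_value_eq hV' (pure w)
  rw [this]
  exact h _ _

theorem ModallyDefinable.closed {K : Set Frame.{u}} (hK : ModallyDefinable S A τ K) :
    ClosedUnderGeneratedSubframes K ∧ ClosedUnderDisjointUnions K ∧
      ClosedUnderBoundedMorphicImages K ∧ ReflectsUltrafilterExtensions K := by
  obtain ⟨Φ, hΦ⟩ := hK
  refine ⟨fun F hF X hX h => ?_, fun I _ F hF => ?_, fun F hF G f hs hf => ?_, fun F hF => ?_⟩
  · exact (hΦ _).2 fun φ hφ => ((hΦ F).1 hF φ hφ).restrict hX h
  · exact (hΦ _).2 fun φ hφ => Frame.Valid.disjointUnion fun i => (hΦ _).1 (hF i) φ hφ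
  · exact (hΦ _).2 fun φ hφ => ((hΦ F).1 hF φ hφ).image hs hf
  · exact (hΦ _).2 fun φ hφ => ((hΦ _).1 hF φ hφ).of_ultrafilterExtension

end Preservation

end FVModal

namespace FVModal

/-! ### Classical modal formulas and their translation -/

/-- Classical modal formulas, in the connectives `∧`, `¬` and `◇`, with variables in `κ`. -/
inductive ClassicalFormula (κ : Type x) : Type x
  | var (p : κ) : ClassicalFormula κ
  | and (φ ψ : ClassicalFormula κ) : ClassicalFormula κ
  | neg (φ : ClassicalFormula κ) : ClassicalFormula κ
  | dia (φ : ClassicalFormula κ) : ClassicalFormula κ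

namespace ClassicalFormula

variable {κ : Type x} {κ' : Type*}

/-- Two-valued truth at a world, for an accessibility relation `r` and a valuation `V`. It is
defined for bare relations, because it is also used in ultraproducts and direct limits. -/
def Sat {W : Type u} (r : W → W → Prop) (V : κ → W → Prop) : ClassicalFormula κ → W → Prop
  | var p, w => V p w
  | and φ ψ, w => φ.Sat r V w ∧ ψ.Sat r V w
  | neg φ, w => ¬ φ.Sat r V w
  | dia φ, w => ∃ v, r w v ∧ φ.Sat r V v

/-- Renaming of variables. -/
def rename (ρ : κ → κ') : ClassicalFormula κ → ClassicalFormula κ'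
  | var p => var (ρ p)
  | and φ ψ => and (φ.rename ρ) (ψ.rename ρ)
  | neg φ => neg (φ.rename ρ)
  | dia φ => dia (φ.rename ρ)

/-- The variables of a formula. -/
def vars : ClassicalFormula κ → Set κ
  | var p => {p}
  | and φ ψ => φ.vars ∪ ψ.vars
  | neg φ => φ.vars
  | dia φ => φ.vars

theorem finite_vars (φ : ClassicalFormula κ) : φ.vars.Finite := by
  induction φ with
  | var p => exact Set.finite_singleton p
  | and φ ψ h₁ h₂ => exact h₁.union h₂
  | neg φ h => exact h
  | dia φ h => exact h

theorem sat_rename {W : Type u} {r : W → W → Prop} {V : κ' → W → Prop} (ρ : κ → κ')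
    (φ : ClassicalFormula κ) (w : W) :
    (φ.rename ρ).Sat r V w ↔ φ.Sat r (fun p => V (ρ p)) w := by
  induction φ generalizing w with
  | var p => rfl
  | and φ ψ h₁ h₂ => simp only [rename, Sat, h₁, h₂]
  | neg φ h => simp only [rename, Sat, h]
  | dia φ h => simp only [rename, Sat, h]

theorem sat_congr {W : Type u} {r : W → W → Prop} {V V' : κ → W → Prop} (φ : ClassicalFormula κ)
    (hV : ∀ p ∈ φ.vars, V p = V' p) (w : W) : φ.Sat r V w ↔ φ.Sat r V' w := by
  induction φ generalizing w with
  | var p => exact iff_of_eq (congrFun (hV p rfl) w)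
  | and φ ψ h₁ h₂ =>
    simp only [Sat, h₁ fun p hp => hV p (Or.inl hp), h₂ fun p hp => hV p (Or.inr hp)]
  | neg φ h => simp only [Sat, h hV]
  | dia φ h => simp only [Sat, h hV]

/-- Two-valued validity in a frame. -/
def ValidIn (φ : ClassicalFormula κ) (F : Frame.{u}) : Prop :=
  ∀ (V : κ → F.W → Prop) (w : F.W), φ.Sat F.R V w

end ClassicalFormula

variable {S : Signature.{w}} {τ : Type x}

/-- Substitution of a formula for the variable of a unary term. -/
def UnaryTerm.subst (φ : Formula S τ) : UnaryTerm S → Formula S τ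
  | .x => φ
  | .and s t => .and (s.subst φ) (t.subst φ)
  | .or s t => .or (s.subst φ) (t.subst φ)
  | .op o t => .op o fun i => (t i).subst φ

/-- The translation of a classical formula that reads negation as the term `u`. -/
def ClassicalFormula.translate (u : UnaryTerm S) : ClassicalFormula τ → Formula S τ
  | .var p => .var p
  | .and φ ψ => .and (φ.translate u) (ψ.translate u)
  | .neg φ => u.subst (φ.translate u)
  | .dia φ => .dia (φ.translate u)

variable {A : Type v} [Lattice A] [BoundedOrder A] [Ops S A]

/-- `q` is the preimage of an ultrafilter of the interpreted Boolean algebra: a two-valued reading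
of the truth values under which `u` is negation and `t` takes the value `⊤` only at true values. -/
structure IsTruthPredicate (u t : UnaryTerm S) (q : A → Prop) : Prop where
  top : q ⊤
  inf : ∀ a b, q (a ⊓ b) ↔ q a ∧ q b
  sup : ∀ a b, q (a ⊔ b) ↔ q a ∨ q b
  neg : ∀ a, q (u.eval A a) ↔ ¬ q a
  of_eval_eq_top : ∀ a, t.eval A a = ⊤ → q a

theorem IsTruthPredicate.bot {u t : UnaryTerm S} {q : A → Prop} (hq : IsTruthPredicate u t q) :
    ¬ q ⊥ := by
  intro h
  have : q (⊥ ⊓ u.eval A ⊤) := by rwa [bot_inf_eq]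
  exact (hq.neg ⊤).1 ((hq.inf _ _).1 this).2 hq.top

/-- Every truth value at which `t` is not `⊤` is false under some truth predicate. -/
theorem IsInterpretation.exists_truthPredicate [Finite A] {u t : UnaryTerm S} {B : Type v}
    [BooleanAlgebra B] (h : IsInterpretation A u t B) {a : A} (ha : t.eval A a ≠ ⊤) :
    ∃ q : A → Prop, IsTruthPredicate u t q ∧ ¬ q a := by
  obtain ⟨e, hinf, hsup, hneg, htop⟩ := h.iso
  have hfin : Finite B := Finite.of_equiv _ e
  have eq_top : ∀ b, e (Quotient.mk _ b) = ⊤ ↔ t.eval A b = ⊤ := by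
    intro b
    rw [← htop, e.injective.eq_iff, Quotient.eq]
    change t.eval A b = t.eval A ⊤ ↔ _
    rw [h.map_one]
  have hne : (e (Quotient.mk _ a))ᶜ ≠ ⊥ := fun hb => ha ((eq_top a).1 (compl_eq_bot.1 hb))
  obtain hb | ⟨c, hc, hca⟩ := IsAtomic.eq_bot_or_exists_atom_le (e (Quotient.mk _ a))ᶜ
  · exact (hne hb).elim
  -- The truth predicate is membership in the ultrafilter of an atom `c` below the complement of `a`.
  have hcompl : ∀ b : B, c ≤ bᶜ ↔ ¬ c ≤ b := by
    intro b
    rw [le_compl_iff_disjoint_right]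
    exact hc.not_le_iff_disjoint.symm
  refine ⟨fun b => c ≤ e (Quotient.mk _ b), ⟨?_, ?_, ?_, ?_, ?_⟩, (hcompl _).1 hca⟩
  · rw [htop]
    exact le_top
  · intro b b'
    rw [hinf, le_inf_iff]
  · intro b b'
    have := hcompl (e (Quotient.mk _ b) ⊔ e (Quotient.mk _ b'))
    rw [compl_sup, le_inf_iff, hcompl, hcompl] at this
    rw [hsup]
    tauto
  · intro b
    rw [hneg]
    exact hcompl _
  · intro b hb
    rw [(eq_top b).2 hb]
    exact le_top

variable [Finite A]

theorem IsTruthPredicate.finSup {u t : UnaryTerm S} {q : A → Prop} (hq : IsTruthPredicate u t q)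
    (X : Set A) : q (finSup X) ↔ ∃ a ∈ X, q a := by
  classical
  have key : ∀ s : Finset A, q (s.sup id) ↔ ∃ a ∈ s, q a := by
    intro s
    induction s using Finset.induction_on with
    | empty => simpa using hq.bot
    | insert a s _ ih => simp [Finset.sup_insert, hq.sup, ih]
  simpa [FVModal.finSup] using key X.toFinite.toFinset

theorem UnaryTerm.value_subst {F : Frame.{u}} {V : τ → F.W → A} (t : UnaryTerm S)
    (φ : Formula S τ) (w : F.W) :
    (t.subst φ).value F V w = t.eval A (φ.value F V w) := by
  induction t with
  | x => rfl
  | and s t h₁ h₂ => simp only [UnaryTerm.subst, Formula.value, UnaryTerm.eval, h₁, h₂]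
  | or s t h₁ h₂ => simp only [UnaryTerm.subst, Formula.value, UnaryTerm.eval, h₁, h₂]
  | op o t h => simp only [UnaryTerm.subst, Formula.value, UnaryTerm.eval, h]

theorem IsTruthPredicate.sat_iff {u t : UnaryTerm S} {q : A → Prop} (hq : IsTruthPredicate u t q)
    {F : Frame.{u}} {V : τ → F.W → A} (φ : ClassicalFormula τ) (w : F.W) :
    φ.Sat F.R (fun p w => q (V p w)) w ↔ q ((φ.translate u).value F V w) := by
  induction φ generalizing w with
  | var p => rfl
  | and φ ψ h₁ h₂ =>
    simp only [ClassicalFormula.Sat, ClassicalFormula.translate, Formula.value, hq.inf, h₁, h₂]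
  | neg φ h =>
    simp only [ClassicalFormula.Sat, ClassicalFormula.translate, UnaryTerm.value_subst, hq.neg, h]
  | dia φ h =>
    simp only [ClassicalFormula.Sat, ClassicalFormula.translate, Formula.value, hq.finSup, h]
    constructor
    · rintro ⟨v, hv, hφ⟩
      exact ⟨_, ⟨v, hv, rfl⟩, hφ⟩
    · rintro ⟨_, ⟨v, hv, rfl⟩, hφ⟩
      exact ⟨v, hv, hφ⟩

/-- Classical validity is expressed by the many-valued validity of the formula obtained by
substituting the translation into the interpreting term. -/
theorem IsInterpretation.valid_subst_translate_iff {u t : UnaryTerm S} {B : Type v}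
    [BooleanAlgebra B] [Nontrivial B] (h : IsInterpretation A u t B) (F : Frame.{u})
    (φ : ClassicalFormula τ) : F.Valid A (t.subst (φ.translate u)) ↔ φ.ValidIn F := by
  classical
  constructor
  · intro hv V w
    have hu : t.eval A (u.eval A ⊤) ≠ ⊤ := by
      intro hu
      obtain ⟨e, -, -, hneg, htop⟩ := h.iso
      have : e (Quotient.mk _ (u.eval A ⊤)) = e (Quotient.mk _ ⊤) :=
        congrArg e (Quotient.sound (hu.trans h.map_one.symm))
      rw [hneg, htop, compl_top] at this
      exact bot_ne_top this
    obtain ⟨q, hq, -⟩ := h.exists_truthPredicate hu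
    -- A two-valued valuation lifts to one with values `⊤` and `⊥`.
    have hV : (fun p w => q (if V p w then (⊤ : A) else ⊥)) = V := by
      funext p w
      by_cases hp : V p w
      · simp [hp, hq.top]
      · simp [hp, hq.bot]
    rw [← hV, hq.sat_iff]
    apply hq.of_eval_eq_top
    rw [← UnaryTerm.value_subst]
    exact hv _ _
  · intro hv V w
    rw [UnaryTerm.value_subst]
    by_contra hne
    obtain ⟨q, hq, hqn⟩ := h.exists_truthPredicate hne
    exact hqn ((hq.sat_iff φ w).1 (hv _ _))

end FVModal

/-! ### Directed limits of elementary embeddings -/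

section ElementaryLimit

open FirstOrder FirstOrder.Language

variable {L : Language} {ι : Type*} [Preorder ι] [IsDirectedOrder ι] [Nonempty ι]
  {G : ι → Type*} [∀ i, L.Structure (G i)] (f : ∀ i j, i ≤ j → G i ↪[L] G j)
  [DirectedSystem G fun i j h => f i j h]

/-- The Tarski–Vaught theorem on elementary directed systems: the canonical maps into the limit
are elementary. -/
theorem FirstOrder.Language.DirectLimit.realize_of_comp
    (hf : ∀ i j (h : i ≤ j) (n : ℕ) (φ : L.BoundedFormula Empty n) (x : Fin n → G i),
      φ.Realize default (f i j h ∘ x) ↔ φ.Realize default x)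
    {n : ℕ} (φ : L.BoundedFormula Empty n) (i : ι) (x : Fin n → G i) :
    φ.Realize default (DirectLimit.of L ι G f i ∘ x) ↔ φ.Realize default x := by
  have elim : ∀ (i : ι) {n : ℕ} (x : Fin n → G i),
      Sum.elim (default : Empty → DirectLimit G f) (DirectLimit.of L ι G f i ∘ x) =
        DirectLimit.of L ι G f i ∘ Sum.elim default x := by
    intro i n x
    funext a
    rcases a with a | a
    · exact a.elim
    · rfl
  induction φ generalizing i with
  | falsum => rfl
  | equal t₁ t₂ =>
    simp only [BoundedFormula.Realize, elim, HomClass.realize_term,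
      (DirectLimit.of L ι G f i).injective.eq_iff]
  | rel R ts =>
    simp only [BoundedFormula.Realize, elim, HomClass.realize_term]
    exact (DirectLimit.of L ι G f i).map_rel R _
  | imp φ ψ h₁ h₂ => simp only [BoundedFormula.Realize, h₁, h₂]
  | all φ h =>
    simp only [BoundedFormula.Realize]
    constructor
    · intro H a
      refine (h i _).1 ?_
      rw [Fin.comp_snoc]
      exact H _
    · intro H z
      obtain ⟨j, y, rfl⟩ := DirectLimit.exists_of z
      obtain ⟨k, hik, hjk⟩ := directed_of (· ≤ ·) i j
      have hx : DirectLimit.of L ι G f i ∘ x = DirectLimit.of L ι G f k ∘ (f i k hik ∘ x) := by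
        funext a
        exact DirectLimit.of_f.symm
      rw [hx, ← DirectLimit.of_f (hij := hjk), ← Fin.comp_snoc]
      exact (h k _).2 ((hf i k hik _ φ.all x).2 H _)

theorem FirstOrder.Language.DirectLimit.realize_sentence
    (hf : ∀ i j (h : i ≤ j) (n : ℕ) (φ : L.BoundedFormula Empty n) (x : Fin n → G i),
      φ.Realize default (f i j h ∘ x) ↔ φ.Realize default x) (i : ι) (φ : L.Sentence) :
    DirectLimit G f ⊨ φ ↔ G i ⊨ φ := by
  have := DirectLimit.realize_of_comp f hf φ i default
  rwa [Subsingleton.elim (DirectLimit.of L ι G f i ∘ default) default] at this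

theorem FirstOrder.Language.DirectedSystem.natLERec_succ_apply {G : ℕ → Type*}
    [∀ i, L.Structure (G i)] (f : ∀ n, G n ↪[L] G (n + 1)) {m n : ℕ} (h : m ≤ n) (x : G m) :
    DirectedSystem.natLERec f m (n + 1) (h.trans n.le_succ) x =
      f n (DirectedSystem.natLERec f m n h x) := by
  rw [DirectedSystem.coe_natLERec, DirectedSystem.coe_natLERec]
  exact Nat.leRecOn_succ h _

theorem FirstOrder.Language.DirectedSystem.natLERec_self_apply {G : ℕ → Type*}
    [∀ i, L.Structure (G i)] (f : ∀ n, G n ↪[L] G (n + 1)) (n : ℕ) (x : G n) :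
    DirectedSystem.natLERec f n n le_rfl x = x := by
  rw [DirectedSystem.coe_natLERec]
  exact Nat.leRecOn_self _

/-- The compositions along a sequence of elementary embeddings are elementary. -/
theorem FirstOrder.Language.DirectedSystem.realize_natLERec {G : ℕ → Type*}
    [∀ i, L.Structure (G i)] (f : ∀ n, G n ↪ₑ[L] G (n + 1)) (i j : ℕ) (h : i ≤ j) (n : ℕ)
    (φ : L.BoundedFormula Empty n) (x : Fin n → G i) :
    φ.Realize default (DirectedSystem.natLERec (fun n => (f n).toEmbedding) i j h ∘ x) ↔
      φ.Realize default x := by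
  induction j, h using Nat.le_induction with
  | base =>
    rw [DirectedSystem.coe_natLERec]
    simp only [Nat.leRecOn_self]
    rfl
  | succ j h ih =>
    rw [← ih, ← (f j).map_boundedFormula, Subsingleton.elim (f j ∘ default) default]
    refine iff_of_eq (congrArg _ ?_)
    funext a
    exact DirectedSystem.natLERec_succ_apply _ h _

end ElementaryLimit

namespace FVModal

open Filter FirstOrder FirstOrder.Language

/-! ### Frames as first-order structures -/

/-- The binary relation of a structure for the language of graphs. -/
def edge {M : Type u} [Language.graph.Structure M] (a b : M) : Prop :=
  Structure.RelMap Language.adj ![a, b]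

/-- The frame of a structure for the language of graphs. -/
def Frame.ofStructure (M : Type u) [Nonempty M] [Language.graph.Structure M] : Frame.{u} where
  W := M
  nonempty := inferInstance
  R := edge

theorem Frame.instStructure_ofStructure (M : Type u) [Nonempty M]
    [inst : Language.graph.Structure M] :
    (Frame.ofStructure M).instStructure = inst := by
  refine Structure.ext ?_ ?_
  · funext n f
    exact f.elim
  · funext n r a
    cases r
    change @Structure.RelMap _ M inst _ Language.adj ![a 0, a 1] =
      @Structure.RelMap _ M inst _ Language.adj a
    congr 1
    funext i
    fin_cases i <;> rfl

theorem Frame.models_ofStructure (M : Type u) [Nonempty M] [Language.graph.Structure M]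
    (T : Language.graph.Theory) : (Frame.ofStructure M).W ⊨ T ↔ M ⊨ T := by
  have key := Frame.instStructure_ofStructure M
  change @Theory.Model _ M (Frame.ofStructure M).instStructure T ↔ _
  rw [key]

theorem edge_map {M N : Type u} [Language.graph.Structure M] [Language.graph.Structure N]
    (f : M ↪[Language.graph] N) (a b : M) : edge (f a) (f b) ↔ edge a b := by
  rw [edge, edge, ← f.map_rel]
  refine iff_of_eq (congrArg _ ?_)
  funext i
  fin_cases i <;> rfl

section Ultraproduct

variable {ι : Type u} {U : Ultrafilter ι} {M : ι → Type u} [∀ i, Language.graph.Structure (M i)]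

theorem edge_ultraproduct (a b : ∀ i, M i) :
    edge (a : (U : Filter ι).Product M) (b : (U : Filter ι).Product M) ↔
      ∀ᶠ i in U, edge (a i) (b i) := by
  let c : Fin 2 → ∀ i, M i := ![a, b]
  have h₁ : ![(a : (U : Filter ι).Product M), (b : (U : Filter ι).Product M)] =
      fun j => (c j : (U : Filter ι).Product M) := by
    funext j
    fin_cases j <;> rfl
  have h₂ : ∀ i, ![a i, b i] = fun j => c j i := by
    intro i
    funext j
    fin_cases j <;> rfl
  simp only [edge, h₁, h₂]
  exact relMap_quotient_mk' (L := Language.graph) (s := (U : Filter ι).productSetoid M)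
    Language.adj c

/-- The diagonal embedding into an ultrapower. -/
def diagonal {ι : Type u} (U : Ultrafilter ι) (M : Type u) [Nonempty M]
    [Language.graph.Structure M] :
    M ↪ₑ[Language.graph] ((U : Filter ι).Product fun _ => M) where
  toFun a := ((fun _ => a : ι → M) : (U : Filter ι).Product fun _ => M)
  map_formula' n φ x := by
    refine (Ultraproduct.realize_formula_cast φ fun i _ => x i).trans ?_
    exact Filter.eventually_const

end Ultraproduct

/-! ### Frames over an ultrafilter extension -/

/-- The worlds that see a world in `X`. -/
def Frame.preimage (F : Frame.{u}) (X : Set F.W) : Set F.W := {w | ∃ v ∈ X, F.R w v}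

/-- A frame over the ultrafilter extension of `F`, presented as a first-order structure: a map to
the ultrafilters on `F.W` for which `F.preimage` is computed by the relation of the frame. Such a
map preserves the relation; it is a bounded morphism once it has enough points in its fibres. -/
structure Over (F : Frame.{u}) : Type (u + 1) where
  /-- the worlds -/
  carrier : Type u
  [nonempty : Nonempty carrier]
  [str : Language.graph.Structure carrier]
  /-- the map to the ultrafilter extension -/
  toUlt : carrier → Ultrafilter F.W
  mem_toUlt : ∀ (g : carrier) (X : Set F.W),
    F.preimage X ∈ toUlt g ↔ ∃ v, edge g v ∧ X ∈ toUlt v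

attribute [instance] Over.nonempty Over.str

namespace Over

variable {F : Frame.{u}}

theorem R_toUlt (s : Over F) {g v : s.carrier} (h : edge g v) :
    F.ultrafilterExtension.R (s.toUlt g) (s.toUlt v) :=
  fun X hX => (s.mem_toUlt g X).2 ⟨v, h, hX⟩

section Ultrapower

/-- An ultrafilter on the finite families of subsets of `X` that contains the families above any
given one. -/
noncomputable def fineUltrafilter (X : Type u) : Ultrafilter (Finset (Set X)) :=
  Ultrafilter.of atTop

theorem eventually_mem_fineUltrafilter {X : Type u} (Y : Set X) :
    ∀ᶠ s : Finset (Set X) in fineUltrafilter X, Y ∈ s := by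
  classical
  have : ∀ᶠ s : Finset (Set X) in atTop, Y ∈ s :=
    (eventually_ge_atTop {Y}).mono fun s hs => hs (Finset.mem_singleton_self Y)
  exact Ultrafilter.of_le _ this

/-- An ultrapower of a frame over the ultrafilter extension. A set belongs to the ultrafilter of a
world if it belongs to the ultrafilters of almost all its coordinates. -/
noncomputable def ultrapower (s : Over F) : Over F where
  carrier := (fineUltrafilter F.W : Filter (Finset (Set F.W))).Product fun _ => s.carrier
  nonempty := Ultraproduct.Product.instNonempty
  str := inferInstance
  toUlt z := (fineUltrafilter F.W).bind fun i => s.toUlt (Quotient.out z i)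
  mem_toUlt := by
    have mem : ∀ (z : (fineUltrafilter F.W : Filter (Finset (Set F.W))).Product
        fun _ => s.carrier) (X : Set F.W),
        X ∈ (fineUltrafilter F.W).bind (fun i => s.toUlt (Quotient.out z i)) ↔
          ∀ᶠ i : Finset (Set F.W) in fineUltrafilter F.W, X ∈ s.toUlt (Quotient.out z i) :=
      fun _ _ => Iff.rfl
    intro g X
    simp only [mem]
    constructor
    · intro h
      have h' : ∀ᶠ i : Finset (Set F.W) in fineUltrafilter F.W,
          ∃ v, edge (Quotient.out g i) v ∧ X ∈ s.toUlt v :=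
        h.mono fun i hi => (s.mem_toUlt _ _).1 hi
      obtain ⟨v, hv⟩ := h'.choice
      refine ⟨v, ?_, ?_⟩
      · rw [← Quotient.out_eq g]
        exact (edge_ultraproduct _ _).2 (hv.mono fun i hi => hi.1)
      · have := Quotient.mk_out (s :=
          (fineUltrafilter F.W : Filter (Finset (Set F.W))).productSetoid fun _ => s.carrier) v
        filter_upwards [hv, this] with i hi e
        exact e.symm ▸ hi.2
    · rintro ⟨v, hgv, hv⟩
      rw [← Quotient.out_eq g, ← Quotient.out_eq v] at hgv
      filter_upwards [hv, (edge_ultraproduct _ _).1 hgv] with i hi e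
      exact (s.mem_toUlt _ _).2 ⟨_, e, hi⟩

/-- The element of the ultrapower that is given by a family of worlds. -/
noncomputable def ultrapowerMk (s : Over F) (a : Finset (Set F.W) → s.carrier) :
    s.ultrapower.carrier :=
  (a : (fineUltrafilter F.W : Filter (Finset (Set F.W))).Product fun _ => s.carrier)

theorem mem_toUlt_ultrapowerMk (s : Over F) (a : Finset (Set F.W) → s.carrier) (X : Set F.W) :
    X ∈ s.ultrapower.toUlt (s.ultrapowerMk a) ↔
      ∀ᶠ i : Finset (Set F.W) in fineUltrafilter F.W, X ∈ s.toUlt (a i) := by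
  have := Quotient.mk_out (s := (fineUltrafilter F.W : Filter (Finset (Set F.W))).productSetoid
    fun _ => s.carrier) a
  exact Filter.eventually_congr (this.mono fun i e => iff_of_eq (congrArg (X ∈ s.toUlt ·) e))

/-- The diagonal embedding into the ultrapower. -/
noncomputable def toUltrapower (s : Over F) :
    s.carrier ↪ₑ[Language.graph] s.ultrapower.carrier :=
  diagonal (fineUltrafilter F.W) s.carrier

theorem toUlt_toUltrapower (s : Over F) (g : s.carrier) :
    s.ultrapower.toUlt (s.toUltrapower g) = s.toUlt g := by
  refine Ultrafilter.ext fun X => ?_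
  exact (s.mem_toUlt_ultrapowerMk (fun _ => g) X).trans Filter.eventually_const

/-- In the ultrapower, the back condition holds at the old worlds: finite parts of an ultrafilter
`b` that sits above `s.toUlt g` are realized by successors of `g`, and a nonstandard successor
realizes all of `b`. -/
theorem exists_ultrapower_edge (s : Over F) (g : s.carrier) (b : Ultrafilter F.W)
    (hb : F.ultrafilterExtension.R (s.toUlt g) b) :
    ∃ v, edge (s.toUltrapower g) v ∧ s.ultrapower.toUlt v = b := by
  classical
  have key : ∀ i : Finset (Set F.W), ∃ v, edge g v ∧ ∀ X ∈ i, X ∈ b → X ∈ s.toUlt v := by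
    intro i
    have hmem : (⋂ X ∈ i.filter (· ∈ b), X) ∈ b :=
      (Filter.biInter_finset_mem _).2 fun X hX => (Finset.mem_filter.1 hX).2
    obtain ⟨v, hv, hv'⟩ := (s.mem_toUlt g _).1 (hb _ hmem)
    refine ⟨v, hv, fun X hX hXb => ?_⟩
    exact (Filter.biInter_finset_mem _).1 hv' X (Finset.mem_filter.2 ⟨hX, hXb⟩)
  choose v hv hv' using key
  refine ⟨s.ultrapowerMk v, ?_, ?_⟩
  · exact (edge_ultraproduct (fun _ => g) v).2 (Filter.Eventually.of_forall hv)
  · refine Ultrafilter.eq_of_le fun X hX => ?_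
    rw [Ultrafilter.mem_coe, mem_toUlt_ultrapowerMk]
    filter_upwards [eventually_mem_fineUltrafilter X] with i hi
    exact hv' i X hi hX

end Ultrapower

section Limit

variable (s : Over F)

/-- The iterated ultrapowers of `s`. A single one need not satisfy the back condition at its new
worlds; each is repaired by the next. -/
noncomputable def chain : ℕ → Over F
  | 0 => s
  | n + 1 => (chain n).ultrapower

/-- The embedding of an iterated ultrapower into the next one. -/
noncomputable def chainStep (n : ℕ) :
    (s.chain n).carrier ↪ₑ[Language.graph] (s.chain (n + 1)).carrier :=
  (s.chain n).toUltrapower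

/-- The embeddings between the iterated ultrapowers. -/
noncomputable def chainMap (m n : ℕ) (h : m ≤ n) :
    (s.chain m).carrier ↪[Language.graph] (s.chain n).carrier :=
  DirectedSystem.natLERec (G' := fun n => (s.chain n).carrier)
    (fun n => (s.chainStep n).toEmbedding) m n h

instance : DirectedSystem (fun n => (s.chain n).carrier) fun m n h => s.chainMap m n h :=
  DirectedSystem.natLERec.directedSystem _

theorem chainMap_succ {m n : ℕ} (h : m ≤ n) (g : (s.chain m).carrier) :
    s.chainMap m (n + 1) (h.trans n.le_succ) g = s.chainStep n (s.chainMap m n h g) :=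
  DirectedSystem.natLERec_succ_apply (G := fun n => (s.chain n).carrier)
    (fun n => (s.chainStep n).toEmbedding) h g

theorem chainMap_self (n : ℕ) (g : (s.chain n).carrier) : s.chainMap n n le_rfl g = g :=
  DirectedSystem.natLERec_self_apply (G := fun n => (s.chain n).carrier)
    (fun n => (s.chainStep n).toEmbedding) n g

theorem toUlt_chainStep (n : ℕ) (g : (s.chain n).carrier) :
    (s.chain (n + 1)).toUlt (s.chainStep n g) = (s.chain n).toUlt g :=
  (s.chain n).toUlt_toUltrapower g

theorem toUlt_chainMap (m n : ℕ) (h : m ≤ n) (g : (s.chain m).carrier) :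
    (s.chain n).toUlt (s.chainMap m n h g) = (s.chain m).toUlt g := by
  induction n, h using Nat.le_induction with
  | base => rw [chainMap_self]
  | succ n h ih => rw [chainMap_succ _ h, toUlt_chainStep, ih]

/-- The worlds of the limit of the iterated ultrapowers. -/
abbrev LimitCarrier : Type u := Language.DirectLimit (fun n => (s.chain n).carrier) s.chainMap

/-- The canonical embeddings into the limit. -/
noncomputable def toLimit (n : ℕ) : (s.chain n).carrier ↪[Language.graph] s.LimitCarrier :=
  Language.DirectLimit.of Language.graph ℕ (fun n => (s.chain n).carrier) s.chainMap n

theorem exists_toLimit (z : s.LimitCarrier) : ∃ n g, s.toLimit n g = z :=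
  Language.DirectLimit.exists_of z

theorem toLimit_chainMap {m n : ℕ} (h : m ≤ n) (g : (s.chain m).carrier) :
    s.toLimit n (s.chainMap m n h g) = s.toLimit m g :=
  Language.DirectLimit.of_f

/-- The map from the limit to the ultrafilter extension, defined by a choice of representatives. -/
noncomputable def limitToUlt (z : s.LimitCarrier) : Ultrafilter F.W :=
  (s.chain (s.exists_toLimit z).choose).toUlt (s.exists_toLimit z).choose_spec.choose

theorem limitToUlt_toLimit (n : ℕ) (g : (s.chain n).carrier) :
    s.limitToUlt (s.toLimit n g) = (s.chain n).toUlt g := by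
  have h := (s.exists_toLimit (s.toLimit n g)).choose_spec.choose_spec
  rw [limitToUlt]
  generalize (s.exists_toLimit (s.toLimit n g)).choose_spec.choose = g' at h ⊢
  generalize (s.exists_toLimit (s.toLimit n g)).choose = m at g' h ⊢
  rw [← s.toLimit_chainMap (le_max_left m n), ← s.toLimit_chainMap (le_max_right m n)] at h
  rw [← s.toUlt_chainMap m _ (le_max_left m n), ← s.toUlt_chainMap n _ (le_max_right m n),
    (s.toLimit _).injective h]

/-- The limit of the iterated ultrapowers. -/
noncomputable def limit : Over F where
  carrier := s.LimitCarrier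
  nonempty := ⟨s.toLimit 0 (Classical.arbitrary _)⟩
  str := inferInstance
  toUlt := s.limitToUlt
  mem_toUlt z X := by
    obtain ⟨n, g, rfl⟩ := s.exists_toLimit z
    rw [limitToUlt_toLimit, mem_toUlt]
    constructor
    · rintro ⟨v, hgv, hv⟩
      refine ⟨s.toLimit n v, (edge_map _ _ _).2 hgv, ?_⟩
      rwa [limitToUlt_toLimit]
    · rintro ⟨v, hgv, hv⟩
      obtain ⟨m, v, rfl⟩ := s.exists_toLimit v
      rw [← s.toLimit_chainMap (le_max_left m n), ← s.toLimit_chainMap (le_max_right m n),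
        edge_map] at hgv
      rw [← mem_toUlt, ← s.toUlt_chainMap n _ (le_max_right m n), mem_toUlt]
      refine ⟨_, hgv, ?_⟩
      rwa [toUlt_chainMap, ← limitToUlt_toLimit]

theorem models_limit (T : Language.graph.Theory) : s.limit.carrier ⊨ T ↔ s.carrier ⊨ T := by
  have key : ∀ φ : Language.graph.Sentence, s.LimitCarrier ⊨ φ ↔ (s.chain 0).carrier ⊨ φ := by
    intro φ
    refine Language.DirectLimit.realize_sentence _ (fun i j h n φ x => ?_) 0 φ
    exact Language.DirectedSystem.realize_natLERec (G := fun n => (s.chain n).carrier)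
      s.chainStep i j h n φ x
  rw [Theory.model_iff, Theory.model_iff]
  exact forall₂_congr fun φ _ => key φ

/-- The limit maps to the ultrafilter extension by a bounded morphism. -/
theorem isBoundedMorphism_limit : IsBoundedMorphism (Frame.ofStructure s.limit.carrier)
    F.ultrafilterExtension s.limit.toUlt where
  forth _ _ h := s.limit.R_toUlt h
  back z b h := by
    obtain ⟨n, g, rfl⟩ := s.exists_toLimit z
    have h' : F.ultrafilterExtension.R ((s.chain n).toUlt g) b := by
      rwa [← limitToUlt_toLimit]
    obtain ⟨v, hgv, rfl⟩ := (s.chain n).exists_ultrapower_edge g b h'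
    refine ⟨s.toLimit (n + 1) v, ?_, s.limitToUlt_toLimit (n + 1) v⟩
    rw [← s.toLimit_chainMap n.le_succ, s.chainMap_succ le_rfl, chainMap_self]
    exact (edge_map _ _ _).2 hgv

theorem exists_limitToUlt (g : s.carrier) : ∃ z, s.limit.toUlt z = s.toUlt g :=
  ⟨s.toLimit 0 g, s.limitToUlt_toLimit 0 g⟩

end Limit

end Over

end FVModal

namespace FVModal

open Filter FirstOrder FirstOrder.Language

/-! ### Satisfiability of classical types in an elementary class -/

namespace ClassicalFormula

variable {κ : Type x}

/-- A formula that is satisfiable in a frame validating the logic of `K` is satisfiable in `K`,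
whatever its variables: there are enough variables in `τ` to rename them apart. -/
theorem exists_sat_of_logic {τ : Type v} [Infinite τ] {K : Set Frame.{u}} {F : Frame.{u}}
    (hF : ∀ φ : ClassicalFormula τ, (∀ G ∈ K, φ.ValidIn G) → φ.ValidIn F)
    (φ : ClassicalFormula κ) {V : κ → F.W → Prop} {w : F.W} (h : φ.Sat F.R V w) :
    ∃ G ∈ K, ∃ (V' : κ → G.W → Prop) (g : G.W), φ.Sat G.R V' g := by
  classical
  have hfin := φ.finite_vars.to_subtype
  obtain ⟨e⟩ : Nonempty (φ.vars ↪ τ) := by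
    obtain ⟨n, ⟨i⟩⟩ := Finite.exists_equiv_fin φ.vars
    exact ⟨i.toEmbedding.trans (Fin.valEmbedding.trans (Infinite.natEmbedding τ))⟩
  let ρ : κ → τ := fun p => if hp : p ∈ φ.vars then e ⟨p, hp⟩ else Classical.arbitrary τ
  -- `V₀` transports `V` along the renaming.
  let V₀ : τ → F.W → Prop := fun q v => ∃ p : φ.vars, e p = q ∧ V p v
  by_contra hn
  have hval : ∀ G ∈ K, (neg (φ.rename ρ)).ValidIn G := fun G hG V' g hg =>
    hn ⟨G, hG, _, g, (sat_rename ρ φ g).1 hg⟩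
  refine hF _ hval V₀ w ((sat_rename ρ φ w).2 ((φ.sat_congr (fun p hp => ?_) w).2 h))
  funext v
  have hρ : ρ p = e ⟨p, hp⟩ := dif_pos hp
  simp only [V₀, hρ, e.injective.eq_iff, exists_eq_left]

theorem exists_conj [Nonempty κ] (s : Finset (ClassicalFormula κ)) :
    ∃ φ : ClassicalFormula κ, ∀ (W : Type u) (r : W → W → Prop) (V : κ → W → Prop) (w : W),
      φ.Sat r V w ↔ ∀ ψ ∈ s, ψ.Sat r V w := by
  classical
  induction s using Finset.induction_on with
  | empty =>
    let p : ClassicalFormula κ := var (Classical.arbitrary κ)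
    exact ⟨neg (and p (neg p)), fun W r V w => by simp [Sat]⟩
  | insert ψ s _ ih =>
    obtain ⟨φ, hφ⟩ := ih
    exact ⟨and ψ φ, fun W r V w => by simp [Sat, hφ]⟩

/-- Łoś's theorem for modal formulas. -/
theorem sat_ultraproduct {ι : Type u} {U : Ultrafilter ι} {M : ι → Type u}
    [∀ i, Nonempty (M i)] [∀ i, Language.graph.Structure (M i)] (V : ∀ i, κ → M i → Prop)
    (φ : ClassicalFormula κ) (a : ∀ i, M i) :
    φ.Sat edge (fun p (z : (U : Filter ι).Product M) => ∀ᶠ i in U, V i p (Quotient.out z i))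
      (a : (U : Filter ι).Product M) ↔ ∀ᶠ i in U, φ.Sat edge (V i) (a i) := by
  induction φ generalizing a with
  | var p =>
    have := Quotient.mk_out (s := (U : Filter ι).productSetoid M) a
    exact Filter.eventually_congr (this.mono fun i e => iff_of_eq (congrArg (V i p) e))
  | and φ ψ h₁ h₂ => simp only [Sat, h₁, h₂, Filter.eventually_and]
  | neg φ h => simp only [Sat, h, Ultrafilter.eventually_not]
  | dia φ h =>
    simp only [Sat]
    constructor
    · rintro ⟨z, haz, hz⟩
      rw [← Quotient.out_eq z] at haz hz
      filter_upwards [(edge_ultraproduct _ _).1 haz, (h _).1 hz] with i h₁ h₂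
      exact ⟨_, h₁, h₂⟩
    · intro H
      have choice : ∀ i, ∃ v, (∃ v', edge (a i) v' ∧ φ.Sat edge (V i) v') →
          edge (a i) v ∧ φ.Sat edge (V i) v := fun i =>
        ⟨Classical.epsilon _, Classical.epsilon_spec⟩
      choose v hv using choice
      exact ⟨_, (edge_ultraproduct a v).2 (H.mono fun i hi => (hv i hi).1),
        (h v).2 (H.mono fun i hi => (hv i hi).2)⟩

/-- Compactness: if every finite part of a set of modal formulas is satisfiable in an elementary
class of frames, then so is the whole set. -/
theorem exists_sat_of_finite {κ : Type u} [Nonempty κ] {K : Set Frame.{u}} (hK : IsElementary K)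
    (Δ : Set (ClassicalFormula κ))
    (hΔ : ∀ s : Finset (ClassicalFormula κ), ↑s ⊆ Δ →
      ∃ G ∈ K, ∃ (V : κ → G.W → Prop) (g : G.W), ∀ ψ ∈ s, ψ.Sat G.R V g) :
    ∃ G ∈ K, ∃ (V : κ → G.W → Prop) (g : G.W), ∀ ψ ∈ Δ, ψ.Sat G.R V g := by
  classical
  obtain ⟨T, hT⟩ := hK
  have h : ∀ s : Finset Δ, ∃ G ∈ K, ∃ (V : κ → G.W → Prop) (g : G.W),
      ∀ ψ ∈ s, ψ.1.Sat G.R V g := by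
    intro s
    obtain ⟨G, hG, V, g, hg⟩ := hΔ (s.map (Function.Embedding.subtype _)) (by simp)
    exact ⟨G, hG, V, g, fun ψ hψ => hg _ (Finset.mem_map_of_mem _ hψ)⟩
  choose G hG V g hg using h
  have : ∀ s, Nonempty (G s).W := fun s => (G s).nonempty
  let U : Ultrafilter (Finset Δ) := Ultrafilter.of atTop
  let N : Type u := (U : Filter (Finset Δ)).Product fun s => (G s).W
  have : Nonempty N := Ultraproduct.Product.instNonempty
  refine ⟨Frame.ofStructure N, ?_, fun p z => ∀ᶠ s in U, V s p (Quotient.out z s),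
    (g : (U : Filter (Finset Δ)).Product fun s => (G s).W), fun ψ hψ => ?_⟩
  · rw [hT, Frame.models_ofStructure, Theory.model_iff]
    intro φ hφ
    refine (Ultraproduct.sentence_realize φ).2 (Filter.Eventually.of_forall fun s => ?_)
    exact ((Theory.model_iff _).1 ((hT _).1 (hG s))) φ hφ
  · refine (sat_ultraproduct V ψ g).2 ?_
    have hmem : ∀ᶠ s : Finset Δ in U, (⟨ψ, hψ⟩ : Δ) ∈ s := Ultrafilter.of_le _
      ((eventually_ge_atTop {(⟨ψ, hψ⟩ : Δ)}).mono fun s hs => hs (Finset.mem_singleton_self _))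
    exact hmem.mono fun s hs => hg s _ hs

end ClassicalFormula

/-! ### The Goldblatt–Thomason theorem for two truth values -/

/-- The ultrafilter of a world that satisfies all formulas that are true throughout `F` when each
set of worlds is named by a variable. -/
def ultrafilterOfTheory {F : Frame.{u}} {W : Type u} {r : W → W → Prop}
    {V : Set F.W → W → Prop} (g : W)
    (hg : ∀ φ : ClassicalFormula (Set F.W), (∀ w, φ.Sat F.R (fun X w => w ∈ X) w) → φ.Sat r V g) :
    Ultrafilter F.W :=
  have inter : ∀ X Y, V X g → V Y g → V (X ∩ Y) g := by
    intro X Y hX hY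
    have := hg (.neg (.and (.and (.var X) (.var Y)) (.neg (.var (X ∩ Y)))))
      (fun w h => h.2 h.1)
    by_contra hn
    exact this ⟨⟨hX, hY⟩, hn⟩
  have mono : ∀ X Y, X ⊆ Y → V X g → V Y g := by
    intro X Y hXY hX
    have := hg (.neg (.and (.var X) (.neg (.var Y)))) (fun w h => h.2 (hXY h.1))
    by_contra hn
    exact this ⟨hX, hn⟩
  Ultrafilter.ofComplNotMemIff
    { sets := {X | V X g}
      univ_sets := hg (.var Set.univ) fun w => Set.mem_univ w
      sets_of_superset := fun hX hXY => mono _ _ hXY hX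
      inter_sets := fun hX hY => inter _ _ hX hY }
    (by
      intro X
      have h₁ := hg (.neg (.and (.var X) (.var Xᶜ))) (fun w h => h.2 h.1)
      have h₂ := hg (.neg (.and (.neg (.var X)) (.neg (.var Xᶜ)))) (fun w h => h.2 h.1)
      change ¬ V Xᶜ g ↔ V X g
      simp only [ClassicalFormula.Sat] at h₁ h₂
      tauto)

/-- If `F` validates the logic of `K`, then every ultrafilter on `F.W` is in the image of some
frame over the ultrafilter extension of `F` that belongs to `K`: it is a generated subframe of a
frame that satisfies the modal type of the ultrafilter. -/
theorem exists_over_of_logic {τ : Type x} [Infinite τ] {K : Set Frame.{u}} (hK : IsElementary K)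
    (hgen : ClosedUnderGeneratedSubframes K) {F : Frame.{u}}
    (hF : ∀ φ : ClassicalFormula τ, (∀ G ∈ K, φ.ValidIn G) → φ.ValidIn F)
    (a : Ultrafilter F.W) :
    ∃ s : Over F, Frame.ofStructure s.carrier ∈ K ∧ ∃ g, s.toUlt g = a := by
  let Vc : Set F.W → F.W → Prop := fun X w => w ∈ X
  obtain ⟨G, hG, V, g₀, hg₀⟩ := ClassicalFormula.exists_sat_of_finite hK
    {φ : ClassicalFormula (Set F.W) | ∀ᶠ w in a, φ.Sat F.R Vc w} (by
      intro s hs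
      obtain ⟨φ, hφ⟩ := ClassicalFormula.exists_conj.{u} s
      obtain ⟨w, hw⟩ := ((Filter.eventually_all_finset s).2 fun ψ hψ => hs hψ).exists
      obtain ⟨G, hG, V, g, hg⟩ := ClassicalFormula.exists_sat_of_logic hF φ ((hφ _ _ _ w).2 hw)
      exact ⟨G, hG, V, g, (hφ _ _ _ _).1 hg⟩)
  let X : Set G.W := {v | Relation.ReflTransGen G.R g₀ v}
  have hX : X.Nonempty := ⟨g₀, .refl⟩
  have hclosed : ∀ w ∈ X, ∀ v, G.R w v → v ∈ X := fun w hw v hwv => hw.tail hwv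
  -- If `φ` is true throughout `F`, then so is `¬◇¬φ`: the formulas true throughout `F` stay true
  -- along the relation.
  have global : ∀ v ∈ X, ∀ φ : ClassicalFormula (Set F.W), (∀ w, φ.Sat F.R Vc w) →
      φ.Sat G.R V v := by
    intro v hv
    induction hv with
    | refl => exact fun φ hφ => hg₀ φ (Filter.Eventually.of_forall hφ)
    | @tail v v' _ hvv' ih =>
      intro φ hφ
      by_contra hn
      exact ih (.neg (.dia (.neg φ))) (fun w ⟨w', _, h⟩ => h (hφ w')) ⟨v', hvv', hn⟩
  have hres := hgen G hG X hX hclosed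
  have hne : Nonempty (G.restrict X hX).W := (G.restrict X hX).nonempty
  refine ⟨{ carrier := (G.restrict X hX).W
            toUlt := fun v => ultrafilterOfTheory v.1 (global v.1 v.2)
            mem_toUlt := ?_ }, ?_, ⟨g₀, .refl⟩, ?_⟩
  · intro v Y
    have h₁ := global v.1 v.2 (.neg (.and (.var (F.preimage Y)) (.neg (.dia (.var Y)))))
      (fun w ⟨⟨w', hw', h⟩, hn⟩ => hn ⟨w', h, hw'⟩)
    have h₂ := global v.1 v.2 (.neg (.and (.dia (.var Y)) (.neg (.var (F.preimage Y)))))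
      (fun w ⟨⟨w', h, hw'⟩, hn⟩ => hn ⟨w', hw', h⟩)
    change V (F.preimage Y) v.1 ↔ ∃ v' : X, G.R v.1 v'.1 ∧ V Y v'.1
    constructor
    · intro h
      by_contra hn
      refine h₁ ⟨h, ?_⟩
      rintro ⟨v', hvv', hv'⟩
      exact hn ⟨⟨v', hclosed _ v.2 _ hvv'⟩, hvv', hv'⟩
    · rintro ⟨v', hvv', hv'⟩
      by_contra hn
      exact h₂ ⟨⟨v'.1, hvv', hv'⟩, hn⟩
  · obtain ⟨T, hT⟩ := hK
    exact (hT _).2 ((Frame.models_ofStructure _ T).2 ((hT _).1 hres))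
  · exact Ultrafilter.eq_of_le fun Y hY => hg₀ (.var Y) hY

/-- The two-valued Goldblatt–Thomason theorem: an elementary class with the four closure properties
contains every frame that validates its logic. -/
theorem mem_of_logic {τ : Type x} [Infinite τ] {K : Set Frame.{u}} (hK : IsElementary K)
    (hgen : ClosedUnderGeneratedSubframes K) (hdis : ClosedUnderDisjointUnions K)
    (himg : ClosedUnderBoundedMorphicImages K) (hue : ReflectsUltrafilterExtensions K)
    {F : Frame.{u}}
    (hF : ∀ φ : ClassicalFormula τ, (∀ G ∈ K, φ.ValidIn G) → φ.ValidIn F) : F ∈ K := by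
  choose s hs g hg using exists_over_of_logic hK hgen hF
  have hlim : ∀ a, Frame.ofStructure (s a).limit.carrier ∈ K := by
    obtain ⟨T, hT⟩ := hK
    intro a
    rw [hT, Frame.models_ofStructure, Over.models_limit, ← Frame.models_ofStructure, ← hT]
    exact hs a
  have hne : Nonempty (Ultrafilter F.W) := F.ultrafilterExtension.nonempty
  refine hue F (himg _ (hdis (Ultrafilter F.W) _ hlim) _
    (fun z => (s z.1).limit.toUlt z.2) (fun a => ?_) ⟨?_, ?_⟩)
  · obtain ⟨z, hz⟩ := (s a).exists_limitToUlt (g a)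
    exact ⟨⟨a, z⟩, hz.trans (hg a)⟩
  · rintro _ _ ⟨a, z, z', rfl, rfl, h⟩
    exact (s a).isBoundedMorphism_limit.forth z z' h
  · rintro ⟨a, z⟩ b h
    obtain ⟨z', hz', rfl⟩ := (s a).isBoundedMorphism_limit.back z b h
    exact ⟨⟨a, z'⟩, ⟨a, z, z', rfl, rfl, hz'⟩, rfl⟩

end FVModal

theorem corollary4p11 {S : FVModal.Signature.{w}} {A : Type v} [Lattice A] [BoundedOrder A]
    [Finite A] [FVModal.Ops S A] (hA : FVModal.InterpretsBooleanAlgebra S A)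
    (τ : Type x) [Countable τ] [Infinite τ]
    (K : Set FVModal.Frame.{u}) (hK : FVModal.IsElementary K) :
    FVModal.ModallyDefinable S A τ K ↔
      FVModal.ClosedUnderGeneratedSubframes K ∧
      FVModal.ClosedUnderDisjointUnions K ∧
      FVModal.ClosedUnderBoundedMorphicImages K ∧
      FVModal.ReflectsUltrafilterExtensions K := by
  refine ⟨FVModal.ModallyDefinable.closed, fun ⟨hgen, hdis, himg, hue⟩ => ?_⟩
  obtain ⟨u, t, B, _, _, hB⟩ := hA
  refine ⟨{ψ | ∃ φ : FVModal.ClassicalFormula τ, (∀ G ∈ K, φ.ValidIn G) ∧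
    ψ = t.subst (φ.translate u)}, fun F => ⟨?_, fun h => ?_⟩⟩
  · rintro hF _ ⟨φ, hφ, rfl⟩
    exact (hB.valid_subst_translate_iff F φ).2 (hφ F hF)
  · refine FVModal.mem_of_logic (τ := τ) hK hgen hdis himg hue fun φ hφ => ?_
    exact (hB.valid_subst_translate_iff F φ).1 (h _ ⟨φ, hφ, rfl⟩)
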